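/- Let $p$ be a prime, $w\ge 1$, $\ell=p^w$, $q=\ell^2$, and let $m\ge 1$. Let $T_m=\mathbb{F}_q(y_1,\dots,y_m)$ be the $m$-th field of the Garcia–Stichtenoth tower: $T_1=\mathbb{F}_q(y_1)$ is the rational function field and $T_i=T_{i-1}(y_i)$ with $$y_i^{\ell}+y_i=\frac{y_{i-1}^{\ell}}{y_{i-1}^{\ell-1}+1}\qquad(2\le i\le m).$$ Let $\mathcal{A}$ be the group of automorphisms $\sigma$ of $T_m$ over $\mathbb{F}_q$ of the form $\sigma(y_i)=cy_i$ for $1\le i\le m-1$ and $\sigma(y_m)=cy_m+a$, where $c\in\mathbb{F}_\ell^*$ and $a\in\mathbb{F}_q$ with $a^\ell+a=0$. Let $v$ be an integer with $0\le v\le w$, and let $u$ be a positive integer with $u\mid\gcd(p^v-1,\ell-1)$. Let $H$ be the subgroup of order $u$ of $\mathbb{F}_\ell^*$, let $h$ be the least positive integer with $u\mid p^h-1$, and let $W$ be an $\mathbb{F}_{p^h}$-subspace of $\{a\in\mathbb{F}_q:a^\ell+a=0\}$ of dimension $v/h$. Put $$H_1=\{\sigma\in\mathcal{A}:\sigma(y_i)=y_i\text{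 for }1\le i\le m-1,\ \sigma(y_m)=y_m+a\text{ for some }a\in W\},$$ $$H_2=\{\sigma\in\mathcal{A}:\text{there is } c\in H\text{ with }\sigma(y_i)=cy_i\text{ for all }1\le i\le m\}.$$ Then $G=H_1H_2$ is a subgroup of $\mathcal{A}$, it is the (internal) semidirect product $H_1\rtimes H_2$ of its normal subgroup $H_1$ and its subgroup $H_2$, and $|H_1|=p^v$, $|H_2|=u$, $|G|=up^v$. -/

import Mathlib

open scoped Pointwise

namespace GSTower

/-- The subfield `{x ∈ K : x ^ (p ^ n) = x}` of a field `K` of characteristic `p`; it is the field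
with `p ^ n` elements when `K` is finite of order `p ^ N` and `n` is a positive divisor of `N`. -/
def frobeniusFixed (K : Type*) [Field K] (p n : ℕ) [Fact p.Prime] [CharP K p] : Subfield K :=
  (iterateFrobenius K p n).eqLocusField (RingHom.id K)

theorem mem_frobeniusFixed {K : Type*} [Field K] {p n : ℕ} [Fact p.Prime] [CharP K p] {x : K} :
    x ∈ frobeniusFixed K p n ↔ x ^ p ^ n = x := Iff.rfl

/-- The elements `y 1, …, y m` of a field extension of `K` are generators of the first `m` steps of
the Garcia-Stichtenoth tower: `y 1` is a variable over `K`, and each `y i` with `2 ≤ i ≤ m` is a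
root of the equation over `K(y 1, …, y (i - 1))` that defines the tower. (As `y 1` is
transcendental, so is every `y i`, and no denominator vanishes.) The value `y 0` plays no role. -/
structure IsTower (K : Type*) [Field K] {Ω : Type*} [Field Ω] [Algebra K Ω] (l m : ℕ)
    (y : ℕ → Ω) : Prop where
  transcendental : Transcendental K (y 1)
  equation : ∀ i, 2 ≤ i → i ≤ m →
    y i ^ l + y i = y (i - 1) ^ l / (y (i - 1) ^ (l - 1) + 1)

/-- The field `T_m = K(y 1, …, y m)`. -/
def T (K : Type*) [Field K] {Ω : Type*} [Field Ω] [Algebra K Ω] (y : ℕ → Ω) (m : ℕ) :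
    IntermediateField K Ω :=
  IntermediateField.adjoin K (y '' Set.Icc 1 m)

section

variable {K : Type*} [Field K] {Ω : Type*} [Field Ω] [Algebra K Ω] (y : ℕ → Ω) (m : ℕ)

/-- The generator `y i`, for `1 ≤ i ≤ m`, as an element of `T_m`. -/
def gen (i : Set.Icc 1 m) : T K y m :=
  ⟨y i, IntermediateField.subset_adjoin K _ ⟨i, i.2, rfl⟩⟩

/-- The automorphism `σ` of `T_m` over `K` satisfies `σ (y i) = c * y i` for `1 ≤ i ≤ m - 1` and
`σ (y m) = c * y m + a`. -/
def ActsBy (σ : T K y m ≃ₐ[K] T K y m) (c : Kˣ) (a : K) : Prop :=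
  (∀ i : Set.Icc 1 m, (i : ℕ) < m → σ (gen y m i) = algebraMap K _ (c : K) * gen y m i) ∧
  (∀ i : Set.Icc 1 m, (i : ℕ) = m →
    σ (gen y m i) = algebraMap K _ (c : K) * gen y m i + algebraMap K _ a)

variable {y m}

theorem ActsBy.one : ActsBy y m (1 : T K y m ≃ₐ[K] T K y m) 1 0 := by
  constructor <;> intro i _ <;> simp

theorem ActsBy.mul {σ τ : T K y m ≃ₐ[K] T K y m} {c d : Kˣ} {a b : K}
    (hσ : ActsBy y m σ c a) (hτ : ActsBy y m τ d b) :
    ActsBy y m (σ * τ) (c * d) (d * a + b) := by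
  constructor
  · intro i hi
    rw [AlgEquiv.mul_apply, hτ.1 i hi, map_mul, hσ.1 i hi, AlgEquiv.commutes]
    push_cast [map_mul]
    ring
  · intro i hi
    rw [AlgEquiv.mul_apply, hτ.2 i hi, map_add, map_mul, hσ.2 i hi, AlgEquiv.commutes,
      AlgEquiv.commutes]
    push_cast [map_mul, map_add]
    ring

theorem ActsBy.inv {σ : T K y m ≃ₐ[K] T K y m} {c : Kˣ} {a : K} (hσ : ActsBy y m σ c a) :
    ActsBy y m σ⁻¹ c⁻¹ (-((c⁻¹ : Kˣ) * a)) := by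
  have hc : algebraMap K (T K y m) ((c⁻¹ : Kˣ) : K) * algebraMap K (T K y m) (c : K) = 1 := by
    rw [← map_mul, Units.inv_mul, map_one]
  constructor
  · intro i hi
    apply σ.injective
    rw [← AlgEquiv.mul_apply, mul_inv_cancel, AlgEquiv.one_apply, map_mul, AlgEquiv.commutes,
      hσ.1 i hi, ← mul_assoc, hc, one_mul]
  · intro i hi
    apply σ.injective
    rw [← AlgEquiv.mul_apply, mul_inv_cancel, AlgEquiv.one_apply, map_add, map_mul,
      AlgEquiv.commutes, AlgEquiv.commutes, hσ.2 i hi, mul_add, ← mul_assoc, hc, one_mul, map_neg,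
      map_mul]
    ring

variable (y m)

/-- The group of automorphisms `σ` of `T_m` over `K` with `σ (y i) = c * y i` for `i < m` and
`σ (y m) = c * y m + a`, where `c` is a nonzero element of the field of order `p ^ w` and
`a ^ (p ^ w) + a = 0`. -/
def affineGroup (p w : ℕ) [Fact p.Prime] [CharP K p] : Subgroup (T K y m ≃ₐ[K] T K y m) where
  carrier := {σ | ∃ (c : Kˣ) (a : K),
    (c : K) ∈ frobeniusFixed K p w ∧ a ^ p ^ w + a = 0 ∧ ActsBy y m σ c a}
  one_mem' := ⟨1, 0, by simp,
    by simp [(Fact.out : p.Prime).ne_zero], ActsBy.one⟩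
  mul_mem' := by
    rintro σ τ ⟨c, a, hc, ha, hσ⟩ ⟨d, b, hd, hb, hτ⟩
    refine ⟨c * d, d * a + b, by simpa using mul_mem hc hd, ?_, hσ.mul hτ⟩
    rw [add_pow_char_pow, mul_pow, mem_frobeniusFixed.1 hd]
    linear_combination (d : K) * ha + hb
  inv_mem' := by
    rintro σ ⟨c, a, hc, ha, hσ⟩
    have hc' : ((c⁻¹ : Kˣ) : K) ∈ frobeniusFixed K p w := by simpa using inv_mem hc
    refine ⟨c⁻¹, _, hc', ?_, hσ.inv⟩
    have h := map_neg (iterateFrobenius K p w) ((c⁻¹ : Kˣ) * a)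
    simp only [iterateFrobenius_def] at h
    rw [h, mul_pow, mem_frobeniusFixed.1 hc']
    linear_combination -((c⁻¹ : Kˣ) : K) * ha

/-- The automorphisms of `T_m` over `K` that fix `y 1, …, y (m - 1)` and send `y m` to `y m + a`
for some `a ∈ W`. -/
def translations (W : AddSubgroup K) : Subgroup (T K y m ≃ₐ[K] T K y m) where
  carrier := {σ | ∃ a ∈ W, ActsBy y m σ 1 a}
  one_mem' := ⟨0, W.zero_mem, ActsBy.one⟩
  mul_mem' := by
    rintro σ τ ⟨a, ha, hσ⟩ ⟨b, hb, hτ⟩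
    exact ⟨a + b, W.add_mem ha hb, by simpa using hσ.mul hτ⟩
  inv_mem' := by
    rintro σ ⟨a, ha, hσ⟩
    exact ⟨-a, W.neg_mem ha, by simpa using hσ.inv⟩

/-- The automorphisms of `T_m` over `K` that send `y i` to `c * y i` for all `1 ≤ i ≤ m`, with one
and the same `c ∈ H`. -/
def scalings (H : Subgroup Kˣ) : Subgroup (T K y m ≃ₐ[K] T K y m) where
  carrier := {σ | ∃ c ∈ H, ActsBy y m σ c 0}
  one_mem' := ⟨1, H.one_mem, ActsBy.one⟩
  mul_mem' := by
    rintro σ τ ⟨c, hc, hσ⟩ ⟨d, hd, hτ⟩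
    exact ⟨c * d, H.mul_mem hc hd, by simpa using hσ.mul hτ⟩
  inv_mem' := by
    rintro σ ⟨c, hc, hσ⟩
    exact ⟨c⁻¹, H.inv_mem hc, by simpa using hσ.inv⟩

end

/-- The subgroup `G` is the (internal) semidirect product `N ⋊ H` of its subgroups `N` and `H`:
`N` is normal in `G`, and every element of `G` is `n * h` for exactly one pair `(n, h) ∈ N × H`. -/
structure IsSemidirect {A : Type*} [Group A] (G N H : Subgroup A) : Prop where
  left_le : N ≤ G
  right_le : H ≤ G
  normal : (N.subgroupOf G).Normal
  complement : Subgroup.IsComplement' (N.subgroupOf G) (H.subgroupOf G)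

end GSTower

/-!
Put `l = p ^ w`. Since `y 1` is transcendental, some valuation `v` trivial on `K` has `v (y 1) > 1`.
The equation of the tower then gives `v (y (n + 1)) ^ l = v (y n)`: the pole of `y 1` is totally
ramified. Inductively the values of `T_n` are powers of `v (y n)`, so `1, y (n + 1), …,
y (n + 1) ^ (l - 1)` have values in distinct classes modulo those of `T_n`, and the equation of
`y (n + 1)` is its minimal polynomial over `T_n`. That polynomial is compatible with
`y i ↦ c * y i`, `y m ↦ c * y m + a` whenever `c ^ l = c` and `a ^ l + a = 0`, so each such pair
`(c, a)` comes from exactly one automorphism of `T_m`.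

The order of the field fixed by the `p ^ h`-power map is `p ^ n` for some `n ≤ h`; its unit group
contains `H`, so `u ∣ p ^ n - 1` and minimality of `h` forces `n = h`. Hence `W` is stable under
`H`, and it has `(p ^ h) ^ (v / h) = p ^ v` elements because `h ∣ v`.
-/

namespace GSTower

open Polynomial IntermediateField

section Valuation

variable {E Ω Γ : Type*} [Field E] [Field Ω] [Algebra E Ω] [LinearOrderedCommGroupWithZero Γ]
  {v : Valuation Ω Γ} {x : Ω} {n : ℕ}

/-- The value group of the subfield `E` is contained in the cyclic group generated by `g`. -/
def ValuesInPowers (v : Valuation Ω Γ) (E : Type*) [Field E] [Algebra E Ω] (g : Γ) : Prop :=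
  ∀ e : E, e ≠ 0 → ∃ k : ℤ, v (algebraMap E Ω e) = g ^ k

theorem ValuesInPowers.one_of_isTrivialOn [v.IsTrivialOn E] : ValuesInPowers v E 1 :=
  fun e he ↦ ⟨0, by rw [Valuation.IsTrivialOn.eq_one e he, zpow_zero]⟩

theorem ValuesInPowers.exists_valuation_mul_pow (hE : ValuesInPowers v E (v x ^ n))
    (hx : 1 < v x) {e : E} (he : e ≠ 0) (i : ℕ) :
    ∃ k : ℤ, v (algebraMap E Ω e * x ^ i) = v x ^ (n * k + i) := by
  obtain ⟨k, hk⟩ := hE e he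
  refine ⟨k, ?_⟩
  rw [map_mul, map_pow, hk, zpow_add₀ (zero_lt_one.trans hx).ne', zpow_mul, zpow_natCast,
    zpow_natCast]

theorem ValuesInPowers.eq_of_valuation_mul_pow_eq (hE : ValuesInPowers v E (v x ^ n))
    (hx : 1 < v x) {a b : E} (ha : a ≠ 0) (hb : b ≠ 0) {i j : ℕ} (hi : i < n) (hj : j < n)
    (h : v (algebraMap E Ω a * x ^ i) = v (algebraMap E Ω b * x ^ j)) : i = j := by
  obtain ⟨k, hk⟩ := hE.exists_valuation_mul_pow hx ha i
  obtain ⟨k', hk'⟩ := hE.exists_valuation_mul_pow hx hb j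
  have hexp : n * k + i = n * k' + j :=
    zpow_right_injective₀ (zero_lt_one.trans hx) hx.ne' (hk.symm.trans (h.trans hk'))
  have hdvd : (n : ℤ) ∣ i - j := ⟨k' - k, by linear_combination hexp⟩
  have : (i : ℤ) - j = 0 := Int.eq_zero_of_abs_lt_dvd hdvd (by rw [abs_lt]; omega)
  omega

theorem ValuesInPowers.exists_valuation_aeval (hE : ValuesInPowers v E (v x ^ n))
    (hx : 1 < v x) {P : E[X]} (hP : P ≠ 0) (hdeg : P.natDegree < n) :
    ∃ k : ℤ, v (aeval x P) = v x ^ k := by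
  classical
  let term (j : ℕ) : Ω := algebraMap E Ω (P.coeff j) * x ^ j
  obtain ⟨j, hj, hmax⟩ :=
    Finset.exists_max_image P.support (fun i ↦ v (term i)) (nonempty_support_iff.2 hP)
  have hlt : ∀ i ∈ P.support \ {j}, v (term i) < v (term j) := by
    intro i hi
    obtain ⟨hi, hij⟩ := Finset.mem_sdiff.1 hi
    refine (hmax i hi).lt_of_ne fun h ↦ hij (Finset.mem_singleton.2 ?_)
    exact hE.eq_of_valuation_mul_pow_eq hx (mem_support_iff.1 hi) (mem_support_iff.1 hj)
      ((le_natDegree_of_mem_supp i hi).trans_lt hdeg)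
      ((le_natDegree_of_mem_supp j hj).trans_lt hdeg) h
  have hsum : aeval x P = ∑ i ∈ P.support, term i := by
    rw [aeval_def, eval₂_eq_sum, Polynomial.sum]
  obtain ⟨k, hk⟩ := hE.exists_valuation_mul_pow hx (mem_support_iff.1 hj) j
  exact ⟨n * k + j, by rw [hsum, v.map_sum_eq_of_lt hj hlt, hk]⟩

theorem ValuesInPowers.minpoly_eq (hE : ValuesInPowers v E (v x ^ n)) (hx : 1 < v x)
    {f : E[X]} (hf : f.Monic) (hfn : f.natDegree = n) (hfx : aeval x f = 0) :
    minpoly E x = f := by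
  refine (minpoly.unique E x hf hfx fun q hq hqx ↦ ?_).symm
  by_contra hlt
  obtain ⟨k, hk⟩ := hE.exists_valuation_aeval hx hq.ne_zero
    (hfn ▸ natDegree_lt_natDegree hq.ne_zero (not_le.1 hlt))
  rw [hqx, map_zero] at hk
  exact zpow_ne_zero k (zero_lt_one.trans hx).ne' hk.symm

theorem ValuesInPowers.adjoin_of_aeval (hx : 1 < v x)
    (h : ∀ P : E[X], aeval x P ≠ 0 → ∃ k : ℤ, v (aeval x P) = v x ^ k) :
    ValuesInPowers v E⟮x⟯ (v x) := by
  rintro ⟨z, hz⟩ hz0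
  obtain ⟨r, s, rfl⟩ := (mem_adjoin_simple_iff E z).1 hz
  obtain ⟨hr, hs⟩ := div_ne_zero_iff.1 fun h0 ↦ hz0 (Subtype.ext h0)
  obtain ⟨k, hk⟩ := h r hr
  obtain ⟨k', hk'⟩ := h s hs
  refine ⟨k - k', ?_⟩
  rw [IntermediateField.algebraMap_apply, map_div₀, hk, hk',
    zpow_sub₀ (zero_lt_one.trans hx).ne']

theorem ValuesInPowers.adjoin_of_one (hE : ValuesInPowers v E 1) (hx : 1 < v x) :
    ValuesInPowers v E⟮x⟯ (v x) := by
  refine .adjoin_of_aeval hx fun P hP ↦ ?_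
  have hE' : ValuesInPowers v E (v x ^ (P.natDegree + 1)) := fun e he ↦
    ⟨0, by simpa only [one_zpow, zpow_zero] using (hE e he).choose_spec⟩
  exact hE'.exists_valuation_aeval hx (by rintro rfl; exact hP (map_zero _)) (Nat.lt_succ_self _)

theorem ValuesInPowers.adjoin_of_monic (hE : ValuesInPowers v E (v x ^ n)) (hx : 1 < v x)
    {f : E[X]} (hf : f.Monic) (hfn : f.natDegree = n) (hf1 : f ≠ 1) (hfx : aeval x f = 0) :
    ValuesInPowers v E⟮x⟯ (v x) := by
  refine .adjoin_of_aeval hx fun P hP ↦ ?_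
  rw [← aeval_modByMonic_eq_self_of_root hfx] at hP ⊢
  exact hE.exists_valuation_aeval hx (fun h0 ↦ hP (by rw [h0, map_zero]))
    (hfn ▸ natDegree_modByMonic_lt P hf hf1)

end Valuation

theorem exists_valuationSubring_of_transcendental {K Ω : Type*} [Field K] [Field Ω] [Algebra K Ω]
    {x : Ω} (hx : Transcendental K x) :
    ∃ A : ValuationSubring Ω, A.valuation.IsTrivialOn K ∧ 1 < A.valuation x := by
  have hmem : x ∉ (integralClosure K Ω).toSubring := fun h ↦ hx (IsIntegral.isAlgebraic h)
  obtain ⟨A, hA, hxA⟩ := Subring.exists_le_valuationSubring_of_isIntegrallyClosedIn hmem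
  have hle (e : K) : A.valuation (algebraMap K Ω e) ≤ 1 :=
    (A.valuation_le_one_iff _).2 (hA (isIntegral_algebraMap (x := e)))
  refine ⟨A, ⟨fun e he ↦ (hle e).antisymm ?_⟩, not_le.1 (mt (A.valuation_le_one_iff x).1 hxA)⟩
  have hinv := hle e⁻¹
  rw [map_inv₀, map_inv₀] at hinv
  exact (inv_le_one₀ (by simpa [zero_lt_iff] using he)).1 hinv

section StepEquation

variable {F L Γ : Type*} [Field F] [Field L] [LinearOrderedCommGroupWithZero Γ]
  {v : Valuation L Γ} {l : ℕ} {x : L}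

/-- The rational function `z ↦ z ^ l / (z ^ (l - 1) + 1)`, the right-hand side of the equation
`y i ^ l + y i = stepMap l (y (i - 1))` of the tower. -/
def stepMap (l : ℕ) (z : F) : F :=
  z ^ l / (z ^ (l - 1) + 1)

theorem map_stepMap (φ : F →+* L) (l : ℕ) (z : F) : φ (stepMap l z) = stepMap l (φ z) := by
  simp only [stepMap, map_div₀, map_add, map_pow, map_one]

theorem stepMap_mul {c : F} (hc0 : c ≠ 0) (hl : l ≠ 0) (hc : c ^ l = c) (z : F) :
    stepMap l (c * z) = c * stepMap l z := by
  have hc1 : c ^ (l - 1) = 1 := mul_right_cancel₀ hc0 (by rw [pow_sub_one_mul hl, hc, one_mul])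
  rw [stepMap, stepMap, mul_pow, mul_pow, hc, hc1, one_mul, mul_div_assoc]

theorem valuation_stepMap (hl : 1 < l) (hx : 1 < v x) : v (stepMap l x) = v x := by
  have hlt : v 1 < v (x ^ (l - 1)) := by
    rw [map_one, map_pow]
    exact one_lt_pow₀ hx (by omega)
  rw [stepMap, map_div₀, v.map_add_eq_of_lt_left hlt, map_pow, map_pow,
    div_eq_iff (pow_ne_zero _ (zero_lt_one.trans hx).ne'), mul_pow_sub_one (by omega)]

theorem valuation_pow_add_self (hl : 1 < l) (hx : 1 < v x) : v (x ^ l + x) = v x ^ l := by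
  have hlt : v x < v (x ^ l) := by
    rw [map_pow]
    exact lt_self_pow₀ hx hl
  rw [v.map_add_eq_of_lt_left hlt, map_pow]

theorem one_lt_valuation_of_pow_add_self (h : 1 < v (x ^ l + x)) : 1 < v x := by
  contrapose! h
  exact v.map_add_le (by rw [map_pow]; exact pow_le_one₀ zero_le h) h

/-- The polynomial `X ^ l + X - b`, of which `y i` is a root for `b = stepMap l (y (i - 1))`. -/
noncomputable def stepPoly (l : ℕ) (b : F) : F[X] :=
  X ^ l + X - C b

theorem stepPoly_eq (l : ℕ) (b : F) : stepPoly l b = X ^ l + (X - C b) :=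
  add_sub_assoc _ _ _

theorem monic_stepPoly (hl : 1 < l) (b : F) : (stepPoly l b).Monic := by
  rw [stepPoly_eq]
  exact monic_X_pow_add (by rw [degree_X_sub_C]; exact_mod_cast hl)

theorem natDegree_stepPoly (hl : 1 < l) (b : F) : (stepPoly l b).natDegree = l := by
  rw [stepPoly_eq, natDegree_add_eq_left_of_natDegree_lt, natDegree_X_pow]
  rwa [natDegree_X_pow, natDegree_X_sub_C]

theorem eval₂_stepPoly (φ : F →+* L) (l : ℕ) (b : F) (x : L) :
    (stepPoly l b).eval₂ φ x = x ^ l + x - φ b := by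
  simp only [stepPoly, eval₂_sub, eval₂_add, eval₂_X_pow, eval₂_X, eval₂_C]

theorem affine_pow_add_self {R : Type*} [CommRing R] {p w : ℕ} [Fact p.Prime] [CharP R p]
    {c a : R} (hc : c ^ p ^ w = c) (ha : a ^ p ^ w + a = 0) (x : R) :
    (c * x + a) ^ p ^ w + (c * x + a) = c * (x ^ p ^ w + x) := by
  rw [add_pow_char_pow, mul_pow, hc]
  linear_combination ha

theorem finite_setOf_pow_add_self_eq_zero (F : Type*) [Field F] (hl : 1 < l) :
    {a : F | a ^ l + a = 0}.Finite :=
  (finite_setOfPred_isRoot (monic_stepPoly hl (0 : F)).ne_zero).subset fun a ha ↦ by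
    simpa [stepPoly, IsRoot] using ha

end StepEquation

section Homomorphisms

variable {K Ω L : Type*} [Field K] [Field Ω] [Algebra K Ω] [Field L] [Algebra K L]

theorem exists_algHom_adjoin_of_eval₂_minpoly {E : IntermediateField K Ω} {x : Ω}
    (hx : IsIntegral E x) (φ : E →ₐ[K] L) {x' : L}
    (hx' : (minpoly E x).eval₂ (φ : E →+* L) x' = 0) :
    ∃ ψ : E⟮x⟯.restrictScalars K →ₐ[K] L,
      (∀ e : E, ψ (algebraMap E E⟮x⟯ e) = φ e) ∧ ψ (AdjoinSimple.gen E x) = x' := by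
  let ψ : E⟮x⟯ →ₐ[K] L := (AdjoinRoot.liftAlgHom (minpoly E x) φ x' hx').comp
    ((adjoinRootEquivAdjoin E hx).symm.toAlgHom.restrictScalars K)
  refine ⟨ψ, fun e ↦ ?_, ?_⟩
  · change AdjoinRoot.liftAlgHom _ φ x' hx' ((adjoinRootEquivAdjoin E hx).symm _) = φ e
    rw [AlgEquiv.commutes, AdjoinRoot.algebraMap_eq, AdjoinRoot.liftAlgHom_of]
  · change AdjoinRoot.liftAlgHom _ φ x' hx' ((adjoinRootEquivAdjoin E hx).symm _) = x'
    rw [adjoinRootEquivAdjoin_symm_apply_gen, AdjoinRoot.liftAlgHom_root]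

theorem exists_algHom_adjoin_of_transcendental {x : Ω} (hx : Transcendental K x) {x' : L}
    (hx' : Transcendental K x') : ∃ ψ : K⟮x⟯ →ₐ[K] L, ψ (AdjoinSimple.gen K x) = x' :=
  ⟨(K⟮x'⟯.val.comp (RatFunc.algEquivOfTranscendental x' hx').toAlgHom).comp
    (RatFunc.algEquivOfTranscendental x hx).symm.toAlgHom, by simp⟩

theorem transcendental_affine {x : Ω} (hx : Transcendental K x) {c : K} (hc : c ≠ 0) (a : K) :
    Transcendental K (algebraMap K Ω c * x + algebraMap K Ω a) := by
  have hdeg : (C c * X + C a).natDegree = 1 := natDegree_linear hc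
  have h := hx.aeval (C c * X + C a) (by simp [hdeg]) (by simp [hc])
  rwa [map_add, map_mul, aeval_C, aeval_X, aeval_C] at h

theorem eq_of_affine_eq {x : Ω} (hx : x ∉ Set.range (algebraMap K Ω)) {c d a b : K}
    (h : algebraMap K Ω c * x + algebraMap K Ω a = algebraMap K Ω d * x + algebraMap K Ω b) :
    c = d ∧ a = b := by
  have hcd : c = d := by
    by_contra hne
    have hne' : algebraMap K Ω (c - d) ≠ 0 := (_root_.map_ne_zero _).2 (sub_ne_zero.2 hne)
    refine hx ⟨(b - a) / (c - d), ?_⟩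
    rw [map_div₀, div_eq_iff hne', map_sub, map_sub]
    linear_combination -h
  subst hcd
  exact ⟨rfl, (algebraMap K Ω).injective (add_left_cancel h)⟩

theorem adjoin_range_affine {ι : Type*} (z : ι → Ω) {c : K} (hc : c ≠ 0) (b : ι → K) :
    adjoin K (Set.range fun i ↦ algebraMap K Ω c * z i + algebraMap K Ω (b i)) =
      adjoin K (Set.range z) := by
  apply le_antisymm <;> rw [adjoin_le_iff] <;> rintro _ ⟨i, rfl⟩
  · exact add_mem (mul_mem (IntermediateField.algebraMap_mem _ _) (subset_adjoin K _ ⟨i, rfl⟩))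
      (IntermediateField.algebraMap_mem _ _)
  · have hc' : algebraMap K Ω c ≠ 0 := (_root_.map_ne_zero _).2 hc
    have hz : z i = (algebraMap K Ω c)⁻¹ *
        ((algebraMap K Ω c * z i + algebraMap K Ω (b i)) - algebraMap K Ω (b i)) := by
      rw [add_sub_cancel_right, inv_mul_cancel_left₀ hc']
    rw [SetLike.mem_coe, hz]
    exact mul_mem (inv_mem (IntermediateField.algebraMap_mem _ _))
      (sub_mem (subset_adjoin K _ ⟨i, rfl⟩) (IntermediateField.algebraMap_mem _ _))

end Homomorphisms

section Tower

variable {K Ω L Γ : Type*} [Field K] [Field Ω] [Algebra K Ω] [Field L] [Algebra K L]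
  [LinearOrderedCommGroupWithZero Γ] {v : Valuation Ω Γ} {y : ℕ → Ω} {l m n : ℕ}

theorem T_one : K⟮y 1⟯ = T K y 1 := by
  simp only [T, Set.Icc_self, Set.image_singleton]

theorem T_succ (n : ℕ) : (T K y n)⟮y (n + 1)⟯.restrictScalars K = T K y (n + 1) := by
  rw [T, T, adjoin_adjoin_left, ← Set.insert_Icc_right_eq_Icc_add_one (by omega),
    Set.image_insert_eq, Set.union_singleton]

theorem adjoin_range_gen : adjoin K (Set.range (gen (K := K) y m)) = ⊤ := by
  apply lift_injective
  rw [lift_adjoin, lift_top, ← Set.range_comp]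
  exact congrArg (adjoin K) (Set.image_eq_range _ _).symm

theorem T_algHom_ext {φ χ : T K y m →ₐ[K] L} (h : ∀ i, φ (gen y m i) = χ (gen y m i)) : φ = χ :=
  algHom_ext_of_eq_adjoin _ rfl (by rintro _ ⟨i, hi, rfl⟩; exact h ⟨i, hi⟩)

theorem fieldRange_eq_adjoin_range_gen (φ : T K y m →ₐ[K] L) :
    φ.fieldRange = adjoin K (Set.range fun i ↦ φ (gen y m i)) := by
  rw [AlgHom.fieldRange_eq_map, ← adjoin_range_gen, adjoin_map, ← Set.range_comp]
  rfl

namespace IsTower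

theorem step_equation (hy : IsTower K l m y) (hn : 1 ≤ n) (hnm : n < m) :
    y (n + 1) ^ l + y (n + 1) = stepMap l (y n) :=
  hy.equation (n + 1) (by omega) hnm

theorem one_lt_valuation (hy : IsTower K l m y) (hl : 1 < l) (h1 : 1 < v (y 1)) (hn : 1 ≤ n)
    (hnm : n ≤ m) : 1 < v (y n) := by
  induction n, hn using Nat.le_induction with
  | base => exact h1
  | succ n hn ih =>
    refine one_lt_valuation_of_pow_add_self (l := l) ?_
    rw [hy.step_equation hn hnm, valuation_stepMap hl (ih (by omega))]
    exact ih (by omega)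

theorem valuation_succ_pow (hy : IsTower K l m y) (hl : 1 < l) (h1 : 1 < v (y 1)) (hn : 1 ≤ n)
    (hnm : n < m) : v (y (n + 1)) ^ l = v (y n) := by
  rw [← valuation_pow_add_self hl (hy.one_lt_valuation hl h1 (by omega) hnm),
    hy.step_equation hn hnm, valuation_stepMap hl (hy.one_lt_valuation hl h1 hn hnm.le)]

theorem aeval_stepPoly (hy : IsTower K l m y) (hn : 1 ≤ n) (hnm : n < m) :
    aeval (y (n + 1)) (stepPoly l (stepMap l (gen (K := K) y n ⟨n, hn, le_rfl⟩))) = 0 := by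
  rw [aeval_def, eval₂_stepPoly, hy.step_equation hn hnm, map_stepMap]
  exact sub_self _

theorem valuesInPowers [v.IsTrivialOn K] (hy : IsTower K l m y) (hl : 1 < l) (h1 : 1 < v (y 1))
    (hn : 1 ≤ n) (hnm : n ≤ m) : ValuesInPowers v (T K y n) (v (y n)) := by
  induction n, hn using Nat.le_induction with
  | base => exact T_one (K := K) (y := y) ▸ ValuesInPowers.one_of_isTrivialOn.adjoin_of_one h1
  | succ n hn ih =>
    have hE : ValuesInPowers v (T K y n) (v (y (n + 1)) ^ l) :=
      hy.valuation_succ_pow hl h1 hn hnm ▸ ih (by omega)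
    have hdeg := natDegree_stepPoly hl (stepMap l (gen (K := K) y n ⟨n, hn, le_rfl⟩))
    have hadjoin := hE.adjoin_of_monic (hy.one_lt_valuation hl h1 (by omega) hnm)
      (monic_stepPoly hl _) hdeg (by rintro h; rw [h, natDegree_one] at hdeg; omega)
      (hy.aeval_stepPoly hn hnm)
    exact T_succ (K := K) (y := y) n ▸ hadjoin

theorem notMem_range_algebraMap (hy : IsTower K l m y) (hl : 1 < l) (hn : 1 ≤ n) (hnm : n ≤ m) :
    y n ∉ Set.range (algebraMap K Ω) := by
  obtain ⟨A, _, h1⟩ := exists_valuationSubring_of_transcendental hy.transcendental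
  rintro ⟨e, he⟩
  have hlt := hy.one_lt_valuation hl h1 hn hnm
  rw [← he] at hlt
  exact hlt.not_ge (Valuation.IsTrivialOn.valuation_algebraMap_le_one _ e)

theorem minpoly_eq (hy : IsTower K l m y) (hl : 1 < l) (hn : 1 ≤ n) (hnm : n < m) :
    minpoly (T K y n) (y (n + 1)) = stepPoly l (stepMap l (gen y n ⟨n, hn, le_rfl⟩)) := by
  obtain ⟨A, _, h1⟩ := exists_valuationSubring_of_transcendental hy.transcendental
  have hE : ValuesInPowers A.valuation (T K y n) (A.valuation (y (n + 1)) ^ l) :=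
    hy.valuation_succ_pow hl h1 hn hnm ▸ hy.valuesInPowers hl h1 hn hnm.le
  exact hE.minpoly_eq (hy.one_lt_valuation hl h1 (by omega) hnm) (monic_stepPoly hl _)
    (natDegree_stepPoly hl _) (hy.aeval_stepPoly hn hnm)

theorem exists_algHom_apply_gen {p w : ℕ} [Fact p.Prime] [CharP K p] (hy : IsTower K (p ^ w) m y)
    (hw : w ≠ 0) {c : K} (hc0 : c ≠ 0) (hc : c ^ p ^ w = c) (hn : 1 ≤ n) (hnm : n ≤ m) {a : K}
    (ha : a ^ p ^ w + a = 0) :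
    ∃ ψ : T K y n →ₐ[K] Ω, ∀ i : Set.Icc 1 n, ψ (gen y n i) =
      algebraMap K Ω c * y i + algebraMap K Ω ((Pi.single n a : ℕ → K) i) := by
  have hp : p.Prime := Fact.out
  have hl : 1 < p ^ w := Nat.one_lt_pow hw hp.one_lt
  have : CharP Ω p := charP_of_injective_algebraMap (algebraMap K Ω).injective p
  induction n, hn using Nat.le_induction generalizing a with
  | base =>
    obtain ⟨ψ, hψ⟩ := exists_algHom_adjoin_of_transcendental hy.transcendental
      (transcendental_affine hy.transcendental hc0 a)
    refine ⟨ψ.comp (equivOfEq T_one.symm).toAlgHom, fun ⟨i, h1, hi⟩ ↦ ?_⟩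
    obtain rfl : i = 1 := le_antisymm hi h1
    rw [Pi.single_eq_same]
    exact hψ
  | succ n hn ih =>
    obtain ⟨φ, hφ⟩ := ih (a := 0) (by omega) (by simp [hp.ne_zero])
    simp only [Pi.single_zero, Pi.zero_apply, map_zero, add_zero] at hφ
    have hroot : (minpoly (T K y n) (y (n + 1))).eval₂ (φ : T K y n →+* Ω)
        (algebraMap K Ω c * y (n + 1) + algebraMap K Ω a) = 0 := by
      have hc' : algebraMap K Ω c ^ p ^ w = algebraMap K Ω c := by rw [← map_pow, hc]
      have ha' : algebraMap K Ω a ^ p ^ w + algebraMap K Ω a = 0 := by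
        rw [← map_pow, ← map_add, ha, map_zero]
      rw [hy.minpoly_eq hl hn hnm, eval₂_stepPoly, affine_pow_add_self hc' ha',
        hy.step_equation hn hnm, map_stepMap, RingHom.coe_coe, hφ,
        stepMap_mul ((_root_.map_ne_zero _).2 hc0) (by omega) hc', sub_self]
    obtain ⟨ψ, hψ, hψgen⟩ := exists_algHom_adjoin_of_eval₂_minpoly
      ⟨_, monic_stepPoly hl _, hy.aeval_stepPoly hn hnm⟩ φ hroot
    refine ⟨ψ.comp (equivOfEq (T_succ n).symm).toAlgHom, fun ⟨i, h1, hi⟩ ↦ ?_⟩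
    rcases hi.lt_or_eq with hi | rfl
    · rw [Pi.single_eq_of_ne hi.ne, map_zero, add_zero]
      exact (hψ (gen y n ⟨i, h1, Nat.lt_succ_iff.1 hi⟩)).trans (hφ _)
    · rw [Pi.single_eq_same]
      exact hψgen

end IsTower

theorem actsBy_iff {σ : T K y m ≃ₐ[K] T K y m} {c : Kˣ} {a : K} :
    ActsBy y m σ c a ↔ ∀ i : Set.Icc 1 m, σ (gen y m i) =
      algebraMap K _ (c : K) * gen y m i + algebraMap K _ ((Pi.single m a : ℕ → K) i) := by
  refine ⟨fun h i ↦ ?_, fun h ↦ ⟨fun i hi ↦ ?_, fun i hi ↦ ?_⟩⟩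
  · rcases i.2.2.lt_or_eq with hi | hi
    · rw [h.1 i hi, Pi.single_eq_of_ne hi.ne, map_zero, add_zero]
    · rw [h.2 i hi, hi, Pi.single_eq_same]
  · rw [h i, Pi.single_eq_of_ne hi.ne, map_zero, add_zero]
  · rw [h i, hi, Pi.single_eq_same]

theorem ActsBy.unique {σ τ : T K y m ≃ₐ[K] T K y m} {c : Kˣ} {a : K}
    (hσ : ActsBy y m σ c a) (hτ : ActsBy y m τ c a) : σ = τ :=
  AlgEquiv.coe_toAlgHom_injective <| T_algHom_ext fun i ↦
    (actsBy_iff.1 hσ i).trans (actsBy_iff.1 hτ i).symm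

theorem ActsBy.param_eq (hy : IsTower K l m y) (hl : 1 < l) (hm : 1 ≤ m)
    {σ : T K y m ≃ₐ[K] T K y m} {c d : Kˣ} {a b : K}
    (h : ActsBy y m σ c a) (h' : ActsBy y m σ d b) : c = d ∧ a = b := by
  have heq := congrArg Subtype.val
    ((h.2 ⟨m, hm, le_rfl⟩ rfl).symm.trans (h'.2 ⟨m, hm, le_rfl⟩ rfl))
  obtain ⟨hcd, hab⟩ := eq_of_affine_eq (hy.notMem_range_algebraMap hl hm le_rfl) heq
  exact ⟨Units.ext hcd, hab⟩

variable {p w : ℕ} [Fact p.Prime] [CharP K p]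

theorem IsTower.exists_actsBy (hy : IsTower K (p ^ w) m y) (hw : w ≠ 0) (hm : 1 ≤ m) {c : Kˣ}
    (hc : (c : K) ^ p ^ w = c) {a : K} (ha : a ^ p ^ w + a = 0) :
    ∃ σ : T K y m ≃ₐ[K] T K y m, ActsBy y m σ c a := by
  obtain ⟨ψ, hψ⟩ := hy.exists_algHom_apply_gen hw c.ne_zero hc hm le_rfl ha
  have hrange : ψ.fieldRange = T K y m := by
    simp_rw [fieldRange_eq_adjoin_range_gen, hψ]
    rw [adjoin_range_affine _ c.ne_zero, T, Set.image_eq_range]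
  exact ⟨(AlgEquiv.ofInjectiveField ψ).trans (equivOfEq hrange),
    actsBy_iff.2 fun i ↦ Subtype.ext (hψ i)⟩

theorem IsTower.ncard_setOf_actsBy (hy : IsTower K (p ^ w) m y) (hw : w ≠ 0) (hm : 1 ≤ m)
    {S : Set (Kˣ × K)} (hS : ∀ q ∈ S, (q.1 : K) ^ p ^ w = q.1 ∧ q.2 ^ p ^ w + q.2 = 0) :
    {σ : T K y m ≃ₐ[K] T K y m | ∃ q ∈ S, ActsBy y m σ q.1 q.2}.ncard = S.ncard := by
  have hl : 1 < p ^ w := Nat.one_lt_pow hw (Fact.out : p.Prime).one_lt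
  choose f hf using fun (q : Kˣ × K) (hq : q ∈ S) ↦
    hy.exists_actsBy hw hm (hS q hq).1 (hS q hq).2
  refine (Set.ncard_congr f ?_ ?_ ?_).symm
  · exact fun q hq ↦ ⟨q, hq, hf q hq⟩
  · intro q r hq hr hqr
    exact Prod.ext_iff.2 ((hf q hq).param_eq hy hl hm (hqr ▸ hf r hr))
  · rintro σ ⟨q, hq, hσ⟩
    exact ⟨q, hq, (hf q hq).unique hσ⟩

theorem IsTower.card_translations (hy : IsTower K (p ^ w) m y) (hw : w ≠ 0) (hm : 1 ≤ m)
    {W : AddSubgroup K} (hW : ∀ a ∈ W, a ^ p ^ w + a = 0) :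
    Nat.card (translations y m W) = Nat.card W := by
  have h := hy.ncard_setOf_actsBy hw hm (S := {1} ×ˢ (W : Set K)) <| by
    rintro ⟨_, a⟩ ⟨rfl, ha⟩
    exact ⟨by simp, hW a ha⟩
  simp only [Set.singleton_prod, Set.exists_mem_image, Set.ncard_image_of_injective _
    (Prod.mk_right_injective _)] at h
  exact h

theorem IsTower.card_scalings (hy : IsTower K (p ^ w) m y) (hw : w ≠ 0) (hm : 1 ≤ m)
    {H : Subgroup Kˣ} (hH : ∀ c ∈ H, (c : K) ^ p ^ w = c) :
    Nat.card (scalings y m H) = Nat.card H := by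
  have h := hy.ncard_setOf_actsBy hw hm (S := (H : Set Kˣ) ×ˢ {0}) <| by
    rintro ⟨c, _⟩ ⟨hc, rfl⟩
    exact ⟨hH c hc, by simp [(Fact.out : p.Prime).ne_zero]⟩
  simp only [Set.prod_singleton, Set.exists_mem_image, Set.ncard_image_of_injective _
    (Prod.mk_left_injective _)] at h
  exact h

theorem scalings_le_normalizer_translations {W : AddSubgroup K} {H : Subgroup Kˣ}
    (hHW : ∀ c ∈ H, ∀ a ∈ W, (c : K) * a ∈ W) :
    scalings y m H ≤ Subgroup.normalizer (translations y m W) := by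
  rw [Subgroup.le_normalizer_iff]
  rintro σ ⟨c, hc, hσ⟩ τ ⟨a, ha, hτ⟩
  exact ⟨(c⁻¹ : Kˣ) * a, hHW _ (inv_mem hc) a ha, by simpa using (hσ.mul hτ).mul hσ.inv⟩

theorem IsTower.disjoint_translations_scalings (hy : IsTower K l m y) (hl : 1 < l) (hm : 1 ≤ m)
    (W : AddSubgroup K) (H : Subgroup Kˣ) :
    Disjoint (translations y m W) (scalings y m H) := by
  rw [Subgroup.disjoint_def]
  rintro σ ⟨a, -, ha⟩ ⟨c, -, hc⟩
  obtain ⟨-, rfl⟩ := ha.param_eq hy hl hm hc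
  exact ha.unique ActsBy.one

theorem translations_le_affineGroup {W : AddSubgroup K} (hW : ∀ a ∈ W, a ^ p ^ w + a = 0) :
    translations y m W ≤ affineGroup y m p w := by
  rintro σ ⟨a, ha, hσ⟩
  exact ⟨1, a, one_mem _, hW a ha, hσ⟩

theorem scalings_le_affineGroup {H : Subgroup Kˣ} (hH : ∀ c ∈ H, (c : K) ^ p ^ w = c) :
    scalings y m H ≤ affineGroup y m p w := by
  rintro σ ⟨c, hc, hσ⟩
  exact ⟨c, 0, hH c hc, by simp [(Fact.out : p.Prime).ne_zero], hσ⟩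

end Tower

section Semidirect

variable {A : Type*} [Group A] {G N H : Subgroup A}

theorem isSemidirect_sup (hnorm : H ≤ Subgroup.normalizer N) (hdisj : Disjoint N H) :
    IsSemidirect (N ⊔ H) N H where
  left_le := le_sup_left
  right_le := le_sup_right
  normal := sup_comm N H ▸ Subgroup.normal_subgroupOf_sup_of_le_normalizer hnorm
  complement := by
    refine Subgroup.isComplement'_of_disjoint_and_mul_eq_univ ?_ (Set.eq_univ_of_forall ?_)
    · rw [Subgroup.disjoint_def] at hdisj ⊢
      exact fun hN hH ↦ Subtype.ext (hdisj hN hH)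
    · rintro ⟨g, hg⟩
      rw [← SetLike.mem_coe, Subgroup.coe_mul_of_right_le_normalizer_left N H hnorm] at hg
      obtain ⟨a, ha, b, hb, rfl⟩ := hg
      exact ⟨⟨a, le_sup_left (a := N) ha⟩, ha, ⟨b, le_sup_right (b := H) hb⟩, hb, rfl⟩

theorem IsSemidirect.card_eq (h : IsSemidirect G N H) :
    Nat.card G = Nat.card N * Nat.card H := by
  rw [← h.complement.card_mul_card, Nat.card_congr (Subgroup.subgroupOfEquivOfLe h.left_le).toEquiv,
    Nat.card_congr (Subgroup.subgroupOfEquivOfLe h.right_le).toEquiv]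

end Semidirect

theorem dvd_of_isLeast_dvd_pow_sub_one {p u h t : ℕ}
    (hh : IsLeast {t : ℕ | 0 < t ∧ u ∣ p ^ t - 1} h) (ht : u ∣ p ^ t - 1) : h ∣ t := by
  have hgcd : u ∣ p ^ h.gcd t - 1 := by
    rw [← Nat.pow_sub_one_gcd_pow_sub_one]
    exact Nat.dvd_gcd hh.1.2 ht
  have hle : h ≤ h.gcd t := hh.2 ⟨Nat.gcd_pos_of_pos_left _ hh.1.1, hgcd⟩
  exact Nat.gcd_eq_left_iff_dvd.1 ((Nat.gcd_le_left _ hh.1.1).antisymm hle)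

section FrobeniusFixed

variable {K : Type*} [Field K] {p t : ℕ} [Fact p.Prime] [CharP K p] {H : Subgroup Kˣ}

theorem mem_frobeniusFixed_of_card_dvd (hdvd : Nat.card H ∣ p ^ t - 1) {c : Kˣ} (hc : c ∈ H) :
    (c : K) ∈ frobeniusFixed K p t := by
  have hpow : c ^ (p ^ t - 1) = 1 :=
    orderOf_dvd_iff_pow_eq_one.1 ((H.orderOf_dvd_natCard hc).trans hdvd)
  rw [mem_frobeniusFixed, ← pow_sub_one_mul (pow_pos (Fact.out : p.Prime).pos t).ne',
    ← Units.val_pow_eq_pow_val, hpow, Units.val_one, one_mul]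

theorem coe_frobeniusFixed_eq_rootSet (ht : t ≠ 0) :
    (frobeniusFixed K p t : Set K) = (X ^ p ^ t - X : K[X]).rootSet K := by
  have hne : (X ^ p ^ t - X : K[X]) ≠ 0 :=
    FiniteField.X_pow_card_pow_sub_X_ne_zero K ht (Fact.out : p.Prime).one_lt
  ext x
  rw [SetLike.mem_coe, mem_frobeniusFixed, mem_rootSet_of_ne hne, map_sub, map_pow, aeval_X,
    sub_eq_zero]

theorem finite_frobeniusFixed (ht : t ≠ 0) : Finite (frobeniusFixed K p t) := by
  change (frobeniusFixed K p t : Set K).Finite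
  rw [coe_frobeniusFixed_eq_rootSet ht]
  exact rootSet_finite _ K

theorem card_frobeniusFixed_le (ht : t ≠ 0) : Nat.card (frobeniusFixed K p t) ≤ p ^ t := by
  change (frobeniusFixed K p t : Set K).ncard ≤ p ^ t
  rw [coe_frobeniusFixed_eq_rootSet ht]
  exact (ncard_rootSet_le _ K).trans_eq
    (FiniteField.X_pow_card_pow_sub_X_natDegree_eq K ht (Fact.out : p.Prime).one_lt)

theorem card_dvd_card_frobeniusFixed_sub_one (hdvd : Nat.card H ∣ p ^ t - 1) :
    Nat.card H ∣ Nat.card (frobeniusFixed K p t) - 1 := by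
  let ι : (frobeniusFixed K p t)ˣ →* Kˣ := Units.map (frobeniusFixed K p t).subtype
  have hι : Function.Injective ι := Units.map_injective (frobeniusFixed K p t).subtype.injective
  have hH : H ≤ ι.range := by
    intro c hc
    have hne : (⟨c, mem_frobeniusFixed_of_card_dvd hdvd hc⟩ : frobeniusFixed K p t) ≠ 0 :=
      fun h ↦ c.ne_zero (congrArg Subtype.val h)
    exact ⟨Units.mk0 _ hne, Units.ext rfl⟩
  rw [← Nat.card_units, Nat.card_congr (MonoidHom.ofInjective hι).toEquiv]
  exact Subgroup.card_dvd_of_le hH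

theorem card_frobeniusFixed_of_isLeast {h : ℕ}
    (hh : IsLeast {t : ℕ | 0 < t ∧ Nat.card H ∣ p ^ t - 1} h) :
    Nat.card (frobeniusFixed K p h) = p ^ h := by
  have hfin := finite_frobeniusFixed (K := K) (p := p) hh.1.1.ne'
  have hle := card_frobeniusFixed_le (K := K) (p := p) hh.1.1.ne'
  have := Fintype.ofFinite (frobeniusFixed K p h)
  obtain ⟨n, -, hn⟩ := FiniteField.card (frobeniusFixed K p h) p
  rw [← Nat.card_eq_fintype_card] at hn
  have hdvd := card_dvd_card_frobeniusFixed_sub_one hh.1.2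
  rw [hn] at hdvd
  exact hle.antisymm (hn ▸ Nat.pow_le_pow_right (Fact.out : p.Prime).pos (hh.2 ⟨n.pos, hdvd⟩))

theorem natCard_eq_pow_of_finrank_eq {h v : ℕ}
    (hh : IsLeast {t : ℕ | 0 < t ∧ Nat.card H ∣ p ^ t - 1} h) (hv : Nat.card H ∣ p ^ v - 1)
    {V : Type*} [AddCommGroup V] [Module (frobeniusFixed K p h) V]
    [Module.Finite (frobeniusFixed K p h) V]
    (hdim : Module.finrank (frobeniusFixed K p h) V = v / h) : Nat.card V = p ^ v := by
  rw [Module.natCard_eq_pow_finrank (K := frobeniusFixed K p h), hdim,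
    card_frobeniusFixed_of_isLeast hh, ← pow_mul,
    Nat.mul_div_cancel' (dvd_of_isLeast_dvd_pow_sub_one hh hv)]

end FrobeniusFixed

end GSTower

theorem proposition2p2_general (p w : ℕ) [Fact p.Prime] (hw : 1 ≤ w)
    (K : Type*) [Field K] [CharP K p]
    (Ω : Type*) [Field Ω] [Algebra K Ω] (m : ℕ) (hm : 1 ≤ m)
    (y : ℕ → Ω) (hy : GSTower.IsTower K (p ^ w) m y)
    (v u h : ℕ) (hdvd : u ∣ Nat.gcd (p ^ v - 1) (p ^ w - 1))
    (H : Subgroup Kˣ) (hHcard : Nat.card H = u)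
    (hh : IsLeast {t : ℕ | 0 < t ∧ u ∣ p ^ t - 1} h)
    (W : Submodule (GSTower.frobeniusFixed K p h) K) (hW : ∀ a ∈ W, a ^ p ^ w + a = 0)
    (hWdim : Module.finrank (GSTower.frobeniusFixed K p h) W = v / h) :
    ∃ G : Subgroup (GSTower.T K y m ≃ₐ[K] GSTower.T K y m),
      (G : Set (GSTower.T K y m ≃ₐ[K] GSTower.T K y m)) =
        (GSTower.translations y m W.toAddSubgroup : Set _) *
          (GSTower.scalings y m H : Set _) ∧
      G ≤ GSTower.affineGroup y m p w ∧
      GSTower.IsSemidirect G (GSTower.translations y m W.toAddSubgroup)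
        (GSTower.scalings y m H) ∧
      Nat.card (GSTower.translations y m W.toAddSubgroup) = p ^ v ∧
      Nat.card (GSTower.scalings y m H) = u ∧
      Nat.card G = u * p ^ v := by
  subst hHcard
  obtain ⟨huv, huw⟩ := Nat.dvd_gcd_iff.1 hdvd
  have hw0 : w ≠ 0 := Nat.one_le_iff_ne_zero.1 hw
  have hl : 1 < p ^ w := Nat.one_lt_pow hw0 (Fact.out : p.Prime).one_lt
  have : Finite W := (GSTower.finite_setOf_pow_add_self_eq_zero K hl).subset hW
  have hH : ∀ c ∈ H, (c : K) ^ p ^ w = c := fun _ ↦ GSTower.mem_frobeniusFixed_of_card_dvd huw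
  have hHW : ∀ c ∈ H, ∀ a ∈ W.toAddSubgroup, (c : K) * a ∈ W.toAddSubgroup := fun c hc a ha ↦
    W.smul_mem ⟨c, GSTower.mem_frobeniusFixed_of_card_dvd hh.1.2 hc⟩ ha
  have hnorm := GSTower.scalings_le_normalizer_translations (y := y) (m := m) hHW
  have hsemi := GSTower.isSemidirect_sup hnorm (hy.disjoint_translations_scalings hl hm _ H)
  have hN : Nat.card (GSTower.translations y m W.toAddSubgroup) = p ^ v :=
    (hy.card_translations hw0 hm hW).trans
      (GSTower.natCard_eq_pow_of_finrank_eq (V := W) hh huv hWdim)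
  have hS := hy.card_scalings hw0 hm hH
  refine ⟨_, Subgroup.coe_mul_of_right_le_normalizer_left _ _ hnorm, ?_, hsemi, hN, hS, ?_⟩
  · exact sup_le (GSTower.translations_le_affineGroup hW) (GSTower.scalings_le_affineGroup hH)
  · rw [hsemi.card_eq, hN, hS, mul_comm]

theorem proposition2p2 (p w : ℕ) [Fact p.Prime] (hw : 1 ≤ w)
    (K : Type*) [Field K] [Finite K] [CharP K p] (hK : Nat.card K = (p ^ w) ^ 2)
    (Ω : Type*) [Field Ω] [Algebra K Ω] (m : ℕ) (hm : 1 ≤ m)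
    (y : ℕ → Ω) (hy : GSTower.IsTower K (p ^ w) m y)
    (v u h : ℕ) (hv : v ≤ w) (hu : 0 < u) (hdvd : u ∣ Nat.gcd (p ^ v - 1) (p ^ w - 1))
    (H : Subgroup Kˣ) (hH : ∀ c ∈ H, (c : K) ∈ GSTower.frobeniusFixed K p w)
    (hHcard : Nat.card H = u)
    (hh : IsLeast {t : ℕ | 0 < t ∧ u ∣ p ^ t - 1} h)
    (W : Submodule (GSTower.frobeniusFixed K p h) K) (hW : ∀ a ∈ W, a ^ p ^ w + a = 0)
    (hWdim : Module.finrank (GSTower.frobeniusFixed K p h) W = v / h) :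
    ∃ G : Subgroup (GSTower.T K y m ≃ₐ[K] GSTower.T K y m),
      (G : Set (GSTower.T K y m ≃ₐ[K] GSTower.T K y m)) =
        (GSTower.translations y m W.toAddSubgroup : Set _) *
          (GSTower.scalings y m H : Set _) ∧
      G ≤ GSTower.affineGroup y m p w ∧
      GSTower.IsSemidirect G (GSTower.translations y m W.toAddSubgroup)
        (GSTower.scalings y m H) ∧
      Nat.card (GSTower.translations y m W.toAddSubgroup) = p ^ v ∧
      Nat.card (GSTower.scalings y m H) = u ∧
      Nat.card G = u * p ^ v := by
  exact proposition2p2_general p w hw K Ω m hm y hy v u h hdvd H hHcard hh W hW hWdim
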